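/- Let $G$ be an infinite non-abelian FC-group, that is, a group in which every element has only finitely many conjugates. Let $\omega(G)$ denote the number of orbits of the natural action of the automorphism group $\mathrm{Aut}(G)$ on $G$. (a) If $\omega(G) = 3$, then $G$ is nilpotent of class $2$ and its exponent $\exp(G)$ is equal to $p$ for some odd prime $p$. (b) If $\omega(G) = 4$, then $G$ is nilpotent of class $2$ and its exponent $\exp(G)$ divides $p^2$ for some prime $p$. -/

import Mathlib

/-- `G` is an FC-group: every element has only finitely many conjugates in `G`. -/
def IsFCGroup (G : Type*) [Group G] : Prop :=
  ∀ g : G, (conjugatesOf g).Finite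

/-- The number of orbits of the natural action of `Aut(G)` on `G`
(with the convention that it is `0` if there are infinitely many orbits; a finite number of
orbits is never `0`, since the orbit of `1` exists). -/
noncomputable def numAutOrbits (G : Type*) [Group G] : ℕ :=
  Nat.card (MulAction.orbitRel.Quotient (MulAut G) G)

/-- `G` is nilpotent and its nilpotency class is exactly `c`. -/
def IsNilpotentOfClass (G : Type*) [Group G] (c : ℕ) : Prop :=
  Group.IsNilpotent G ∧ Group.nilpotencyClass G = c

/-! Finitely many orbits bound the class sizes, so G' is finite by Neumann's argument, and every
infinite subset of G leaves G'. Centralizers of finite sets have finite index, hence are infinite.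

If G \ G' is one orbit, a characteristic subgroup meeting it contains it, so is G. Applied to C(G')
this makes G' central; applied to Z(G) it gives Z(G) ≤ G'. If n kills G', n-th powers are then
central, so lie in the finite G'; infinitely many x satisfy x^n = 1, some outside G', so n kills G.
This settles three orbits.

With four orbits, either G \ G' is again one orbit, or G' \ {1} is one and G' has prime exponent p.
In the latter case, if C(G') ≠ G, the chain 1 < G' < C(G') < G accounts for all orbits and makes G a
p-group with trivial centre, contradicting that the finite normal subgroup G' meets the centre. So
G' is central, and p-th powers are analysed along G' ≤ Z(G). -/

/-! ### Finiteness properties of FC-groups -/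

theorem IsFCGroup.finiteIndex_centralizer_singleton {G : Type*} [Group G] (hFC : IsFCGroup G)
    (g : G) : (Subgroup.centralizer {g}).FiniteIndex := by
  have hfin : Finite (MulAction.orbit (ConjAct G) g) := by
    refine Set.Finite.to_subtype ((hFC g).subset ?_)
    rintro x hx
    have := ConjAct.mem_orbit_conjAct.1 hx
    exact this.symm
  have h2 : Finite (ConjAct G ⧸ MulAction.stabilizer (ConjAct G) g) :=
    Finite.of_equiv _ (MulAction.orbitEquivQuotientStabilizer (ConjAct G) g)
  have h3 : (MulAction.stabilizer (ConjAct G) g).FiniteIndex :=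
    Subgroup.finiteIndex_of_finite_quotient
  rw [ConjAct.stabilizer_eq_centralizer] at h3
  exact h3

theorem IsFCGroup.finiteIndex_centralizer {G : Type*} [Group G] (hFC : IsFCGroup G)
    {S : Set G} (hS : S.Finite) : (Subgroup.centralizer S).FiniteIndex := by
  have := hS.to_subtype
  have h : Subgroup.centralizer S = ⨅ g : S, Subgroup.centralizer {(g : G)} := by
    ext x
    simp [Subgroup.mem_iInf, Subgroup.mem_centralizer_iff]
  rw [h]
  exact Subgroup.finiteIndex_iInf fun g => hFC.finiteIndex_centralizer_singleton g

theorem Subgroup.FiniteIndex.infinite {G : Type*} [Group G] [Infinite G] (H : Subgroup G)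
    [H.FiniteIndex] : (H : Set G).Infinite := by
  intro h
  have : Finite H := h.to_subtype
  have h1 := H.card_mul_index
  rw [Nat.card_eq_zero_of_infinite (α := G)] at h1
  rcases Nat.mul_eq_zero.1 h1 with h2 | h2
  · exact Nat.card_pos.ne' h2
  · exact Subgroup.FiniteIndex.index_ne_zero h2

open scoped commutatorElement in
/-- B. H. Neumann: bounded conjugacy classes force finitely many commutators. -/
theorem IsFCGroup.finite_commutatorSet {G : Type*} [Group G] (hFC : IsFCGroup G) (a : G)
    (ha : ∀ g : G, (conjugatesOf g).ncard ≤ (conjugatesOf a).ncard) :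
    (commutatorSet G).Finite := by
  classical
  have hb : ∀ c : G, ∃ b : G, c ∈ conjugatesOf a → b * a * b⁻¹ = c := by
    intro c
    by_cases hc : c ∈ conjugatesOf a
    · obtain ⟨b, hb⟩ := isConj_iff.1 hc
      exact ⟨b, fun _ => hb⟩
    · exact ⟨1, fun h => absurd h hc⟩
  choose b hb using hb
  let U := Subgroup.centralizer (b '' conjugatesOf a)
  have hU : U.FiniteIndex := hFC.finiteIndex_centralizer ((hFC a).image b)
  let K : Set G := Set.image2 (fun c d => c * d⁻¹) (conjugatesOf a) (conjugatesOf a)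
  have hK : K.Finite := (hFC a).image2 _ (hFC a)
  have key : ∀ u ∈ U, ∀ g : G, u⁻¹ * (g * u * g⁻¹) ∈ K := by
    intro u hu g
    -- `u` commutes with the chosen conjugators `b c`; maximality of the class of `a` then turns
    -- this inclusion into an equality.
    have hsub : (fun c => u * c) '' conjugatesOf a ⊆ conjugatesOf (u * a) := by
      rintro _ ⟨c, hc, rfl⟩
      refine isConj_iff.2 ⟨b c, ?_⟩
      have h1 : b c * u = u * b c := Subgroup.mem_centralizer_iff.1 hu _ ⟨c, hc, rfl⟩
      rw [← mul_assoc, h1, mul_assoc, mul_assoc, ← mul_assoc (b c), hb c hc]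
    have heq := Set.eq_of_subset_of_ncard_le hsub
      (by rw [Set.ncard_image_of_injective _ (mul_right_injective u)]; exact ha _) (hFC (u * a))
    have hmem : g * (u * a) * g⁻¹ ∈ conjugatesOf (u * a) := isConj_iff.2 ⟨g, rfl⟩
    rw [← heq] at hmem
    obtain ⟨c, hc, hc'⟩ := hmem
    refine ⟨c, hc, g * a * g⁻¹, isConj_iff.2 ⟨g, rfl⟩, ?_⟩
    have : c = u⁻¹ * (g * (u * a) * g⁻¹) := by rw [← hc']; simp
    rw [this]
    group
  have key2 : ∀ u ∈ U, ∀ g : G, ⁅u, g⁆ ∈ K := by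
    intro u hu g
    have := key u⁻¹ (inv_mem hu) g
    rw [inv_inv] at this
    simpa [commutatorElement_def, mul_assoc] using this
  have hQ : Finite (G ⧸ U) := Subgroup.finite_quotient_of_finiteIndex
  -- With t the representative of xU and x = t u⁻¹, one has [x,h] = t[u⁻¹,h]t⁻¹ · t(h t⁻¹ h⁻¹).
  let F : G ⧸ U → Set G := fun q =>
    Set.image2 (fun k c => (q.out * k * q.out⁻¹) * (q.out * c)) K (conjugatesOf q.out⁻¹)
  refine Set.Finite.subset (Set.finite_iUnion fun q => hK.image2 _ (hFC q.out⁻¹) : (⋃ q, F q).Finite) ?_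
  rintro _ ⟨x, h, rfl⟩
  obtain ⟨u, hu⟩ := QuotientGroup.mk_out_eq_mul U x
  rw [Set.mem_iUnion]
  refine ⟨(x : G ⧸ U), ⁅(u : G)⁻¹, h⁆, key2 _ (inv_mem u.2) h, h * (x : G ⧸ U).out⁻¹ * h⁻¹,
    isConj_iff.2 ⟨h, rfl⟩, ?_⟩
  simp only [hu, commutatorElement_def]
  group

/-- A maximal commuting set is infinite, since a finite one could be enlarged from its infinite
centralizer. Infinitely many of its members share an n-th power, and their quotients are killed by
n. -/
theorem IsFCGroup.infinite_pow_eq_one {G : Type*} [Group G] [Infinite G] (hFC : IsFCGroup G)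
    {F : Set G} (hF : F.Finite) (n : ℕ) (h : ∀ x : G, x ^ n ∈ F) :
    {x : G | x ^ n = 1}.Infinite := by
  obtain ⟨S, hS⟩ := zorn_subset {S : Set G | ∀ x ∈ S, ∀ y ∈ S, x * y = y * x} (by
    intro c hc hchain
    refine ⟨⋃₀ c, ?_, fun s hs => Set.subset_sUnion_of_mem hs⟩
    rintro x ⟨s, hs, hx⟩ y ⟨t, ht, hy⟩
    rcases hchain.total hs ht with hst | hst
    · exact hc ht x (hst hx) y hy
    · exact hc hs x hx y (hst hy))
  have hSinf : S.Infinite := by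
    intro hfin
    have := hFC.finiteIndex_centralizer hfin
    obtain ⟨c, hc, hcS⟩ := (Subgroup.FiniteIndex.infinite (Subgroup.centralizer S)).exists_notMem_finite hfin
    have hc' := Subgroup.mem_centralizer_iff.1 hc
    refine hcS (hS.2 (y := insert c S) ?_ (Set.subset_insert c S) (Set.mem_insert c S))
    rintro x (rfl | hx) y (rfl | hy)
    · rfl
    · exact (hc' y hy).symm
    · exact hc' x hx
    · exact hS.1 x hx y hy
  have := hSinf.to_subtype
  have := hF.to_subtype
  obtain ⟨f, hf⟩ := Finite.exists_infinite_fiber (fun x : S => (⟨x ^ n, h x⟩ : F))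
  obtain ⟨x, hx⟩ := (Set.infinite_coe_iff.1 hf).nonempty
  refine Set.Infinite.mono (s := (fun y : S => (x : G) * (y : G)⁻¹) ''
    ((fun x : S => (⟨x ^ n, h x⟩ : F)) ⁻¹' {f})) ?_ ((Set.infinite_coe_iff.1 hf).image ?_)
  · rintro _ ⟨y, hy, rfl⟩
    have hxy : (x : G) ^ n = (y : G) ^ n := congrArg Subtype.val (hx.trans hy.symm)
    have hcomm : Commute (x : G) (y : G)⁻¹ := (show Commute (x : G) y from hS.1 x x.2 y y.2).inv_right
    show ((x : G) * (y : G)⁻¹) ^ n = 1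
    rw [hcomm.mul_pow, inv_pow, hxy, mul_inv_cancel]
  · intro y _ z _ hyz
    exact Subtype.ext (inv_injective (mul_left_cancel hyz))

/-! ### Automorphism orbits and their invariants -/

/-- Two elements are related if some automorphism maps one to the other. -/
def AutRel {G : Type*} [Group G] (a b : G) : Prop := ∃ φ : MulAut G, φ a = b

theorem exists_autRel_of_numAutOrbits_lt {G : Type*} [Group G] {k : ℕ} (f : Fin k → G)
    (h0 : numAutOrbits G ≠ 0) (hk : numAutOrbits G < k) : ∃ i j, i < j ∧ AutRel (f i) (f j) := by
  have hfin : Finite (MulAction.orbitRel.Quotient (MulAut G) G) := Nat.finite_of_card_ne_zero h0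
  have := Fintype.ofFinite (MulAction.orbitRel.Quotient (MulAut G) G)
  have key : ∀ a b : G, (Quotient.mk'' a : MulAction.orbitRel.Quotient (MulAut G) G) =
      Quotient.mk'' b → AutRel b a := by
    intro a b hab
    obtain ⟨φ, hφ⟩ := MulAction.orbitRel_apply.1 (Quotient.exact' hab)
    exact ⟨φ, hφ⟩
  obtain ⟨i, j, hij, h⟩ := Fintype.exists_ne_map_eq_of_card_lt
    (fun i => (Quotient.mk'' (f i) : MulAction.orbitRel.Quotient (MulAut G) G))
    (by rw [Fintype.card_fin, ← Nat.card_eq_fintype_card]; exact hk)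
  rcases lt_or_gt_of_ne hij with hlt | hlt
  · exact ⟨i, j, hlt, key _ _ h.symm⟩
  · exact ⟨j, i, hlt, key _ _ h⟩

namespace AutRel
variable {G : Type*} [Group G] {a b : G}

theorem orderOf_eq (h : AutRel a b) : orderOf a = orderOf b := by
  obtain ⟨φ, rfl⟩ := h
  exact (MulEquiv.orderOf_eq φ a).symm

theorem pow_eq_one_iff (h : AutRel a b) (n : ℕ) : a ^ n = 1 ↔ b ^ n = 1 := by
  rw [← orderOf_dvd_iff_pow_eq_one, ← orderOf_dvd_iff_pow_eq_one, h.orderOf_eq]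

theorem eq_one_iff (h : AutRel a b) : a = 1 ↔ b = 1 := by
  simpa using h.pow_eq_one_iff 1

theorem mem_iff (h : AutRel a b) (H : Subgroup G) [hH : H.Characteristic] : a ∈ H ↔ b ∈ H := by
  obtain ⟨φ, rfl⟩ := h
  conv_lhs => rw [← hH.fixed φ]
  rfl

theorem ncard_conjugatesOf_eq (h : AutRel a b) :
    (conjugatesOf a).ncard = (conjugatesOf b).ncard := by
  obtain ⟨φ, rfl⟩ := h
  rw [← Set.ncard_image_of_injective _ φ.injective]
  congr 1
  ext x
  constructor
  · rintro ⟨y, hy, rfl⟩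
    obtain ⟨c, rfl⟩ := isConj_iff.1 hy
    exact isConj_iff.2 ⟨φ c, by simp⟩
  · intro hx
    obtain ⟨c, rfl⟩ := isConj_iff.1 hx
    exact ⟨φ.symm c * a * (φ.symm c)⁻¹, isConj_iff.2 ⟨_, rfl⟩, by simp⟩

end AutRel

theorem IsFCGroup.finite_commutator {G : Type*} [Group G] (hFC : IsFCGroup G)
    (h0 : numAutOrbits G ≠ 0) : Finite (commutator G) := by
  have hfin : Finite (MulAction.orbitRel.Quotient (MulAut G) G) := Nat.finite_of_card_ne_zero h0
  have : Nonempty (MulAction.orbitRel.Quotient (MulAut G) G) := ⟨Quotient.mk'' 1⟩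
  obtain ⟨q, hq⟩ := Finite.exists_max
    (fun q : MulAction.orbitRel.Quotient (MulAut G) G => (conjugatesOf q.out).ncard)
  have h : ∀ g : G, (conjugatesOf g).ncard ≤ (conjugatesOf q.out).ncard := by
    intro g
    refine le_trans (le_of_eq ?_) (hq (Quotient.mk'' g))
    obtain ⟨φ, hφ⟩ := MulAction.orbitRel_apply.1
      (Quotient.exact' (Quotient.out_eq' (Quotient.mk'' g : MulAction.orbitRel.Quotient (MulAut G) G)))
    exact AutRel.ncard_conjugatesOf_eq ⟨φ, hφ⟩
  have := (hFC.finite_commutatorSet q.out h).to_subtype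
  infer_instance

theorem isNilpotentOfClass_two {G : Type*} [Group G] (h : commutator G ≤ Subgroup.center G)
    (hna : ∃ a b : G, a * b ≠ b * a) : IsNilpotentOfClass G 2 := by
  have h2 : Subgroup.upperCentralSeries G 2 = ⊤ := by
    rw [eq_top_iff]
    intro x _
    rw [Subgroup.mem_upperCentralSeries_succ_iff]
    intro y
    rw [Subgroup.upperCentralSeries_one]
    exact h (Subgroup.commutator_mem_commutator (Subgroup.mem_top x) (Subgroup.mem_top y))
  have hnil : Group.IsNilpotent G := ⟨2, h2⟩
  refine ⟨hnil, le_antisymm (Subgroup.upperCentralSeries_eq_top_iff_nilpotencyClass_le.1 h2) ?_⟩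
  by_contra hlt
  have h1 : Subgroup.upperCentralSeries G 1 = ⊤ :=
    Subgroup.upperCentralSeries_eq_top_iff_nilpotencyClass_le.2 (by omega)
  rw [Subgroup.upperCentralSeries_one] at h1
  obtain ⟨a, b, hab⟩ := hna
  exact hab (Subgroup.mem_center_iff.1 (h1 ▸ Subgroup.mem_top b) a)

/-- If all elements outside a proper subgroup have the same positive order, then this order is a
prime power. -/
theorem exists_prime_pow_of_orderOf_eq {G : Type*} [Group G] (H : Subgroup G) {m : ℕ} (hm : m ≠ 0)
    {x : G} (hx : x ∉ H) (h : ∀ y ∉ H, orderOf y = m) : ∃ p k, p.Prime ∧ m = p ^ k := by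
  have hm1 : m ≠ 1 := by
    rintro rfl
    exact hx (orderOf_eq_one_iff.1 (h x hx) ▸ H.one_mem)
  obtain ⟨p, hp, hpm⟩ := Nat.exists_prime_and_dvd hm1
  obtain ⟨k, r, hpr, hr⟩ := Nat.exists_eq_pow_mul_and_not_dvd hm p hp.ne_one
  have hk : k ≠ 0 := by
    rintro rfl
    rw [pow_zero, one_mul] at hr
    exact hpr (hr ▸ hpm)
  refine ⟨p, k, hp, ?_⟩
  by_contra hne
  have hordx := h x hx
  have hr0 : r ≠ 0 := by rintro rfl; simp at hpr
  -- Outside H this power would have order m / p ^ k < m; likewise for `x ^ r`. Bézout then puts x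
  -- in H.
  have h1 : x ^ p ^ k ∈ H := by
    by_contra hc
    have h1 := h _ hc
    rw [orderOf_pow' _ (pow_ne_zero k hp.ne_zero), hordx, Nat.gcd_eq_right (hr ▸ Dvd.intro _ rfl)] at h1
    have := Nat.div_lt_self (Nat.pos_of_ne_zero hm) (Nat.one_lt_pow hk hp.one_lt)
    omega
  have h2 : x ^ r ∈ H := by
    by_contra hc
    have h1 := h _ hc
    rw [orderOf_pow' _ hr0, hordx, Nat.gcd_eq_right (hr ▸ Dvd.intro_left _ rfl)] at h1
    have hr1 : 1 < r := by
      rcases Nat.lt_or_ge 1 r with h | h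
      · exact h
      · have : r = 1 := by omega
        subst this
        simp at hr
        exact absurd hr hne
    have := Nat.div_lt_self (Nat.pos_of_ne_zero hm) hr1
    omega
  have hcop : IsCoprime ((p ^ k : ℕ) : ℤ) (r : ℤ) :=
    Nat.isCoprime_iff_coprime.2 (Nat.Coprime.pow_left k ((Nat.Prime.coprime_iff_not_dvd hp).2 hpr))
  obtain ⟨u, v, huv⟩ := hcop
  apply hx
  have : x = (x ^ p ^ k) ^ u * (x ^ r) ^ v := by
    rw [← zpow_natCast x (p ^ k), ← zpow_natCast x r, ← zpow_mul, ← zpow_mul, ← zpow_add,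
      mul_comm _ u, mul_comm _ v, huv, zpow_one]
  rw [this]
  exact mul_mem (H.zpow_mem h1 u) (H.zpow_mem h2 v)

/-! ### Pigeonhole on orbits -/

theorem autRel_of_numAutOrbits_eq_three {G : Type*} [Group G] (h3 : numAutOrbits G = 3)
    {a b c : G} (ha : a ≠ 1) (hb : b ≠ 1) (hc : c ≠ 1) :
    AutRel a b ∨ AutRel a c ∨ AutRel b c := by
  obtain ⟨i, j, hij, h⟩ := exists_autRel_of_numAutOrbits_lt ![1, a, b, c] (by omega) (by omega)
  have h1 := h.eq_one_iff
  fin_cases i <;> fin_cases j <;> simp_all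

theorem autRel_of_numAutOrbits_eq_four {G : Type*} [Group G] (h4 : numAutOrbits G = 4)
    {a b c d : G} (ha : a ≠ 1) (hb : b ≠ 1) (hc : c ≠ 1) (hd : d ≠ 1) :
    AutRel a b ∨ AutRel a c ∨ AutRel a d ∨ AutRel b c ∨ AutRel b d ∨ AutRel c d := by
  obtain ⟨i, j, hij, h⟩ := exists_autRel_of_numAutOrbits_lt ![1, a, b, c, d] (by omega) (by omega)
  have h1 := h.eq_one_iff
  fin_cases i <;> fin_cases j <;> simp_all

/-- The four-orbit pigeonhole principle along a chain of two characteristic subgroups. -/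
theorem autRel_of_notMem_of_le {G : Type*} [Group G] (h4 : numAutOrbits G = 4)
    {H K : Subgroup G} [H.Characteristic] [K.Characteristic] (hHK : H ≤ K) {g k x y : G}
    (hg : g ∈ H) (hg1 : g ≠ 1) (hk : k ∈ K) (hkH : k ∉ H) (hx : x ∉ K) (hy : y ∉ K) :
    AutRel x y := by
  have h1 : ∀ {z : G}, z ∉ K → z ≠ 1 := by
    rintro z hz rfl
    exact hz K.one_mem
  have hk1 : k ≠ 1 := by
    rintro rfl
    exact hkH H.one_mem
  rcases autRel_of_numAutOrbits_eq_four h4 hg1 hk1 (h1 hx) (h1 hy) with h | h | h | h | h | h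
  · exact absurd ((h.mem_iff H).1 hg) hkH
  · exact absurd ((h.mem_iff K).1 (hHK hg)) hx
  · exact absurd ((h.mem_iff K).1 (hHK hg)) hy
  · exact absurd ((h.mem_iff K).1 hk) hx
  · exact absurd ((h.mem_iff K).1 hk) hy
  · exact h

theorem autRel_of_mem_of_notMem {G : Type*} [Group G] (h4 : numAutOrbits G = 4)
    {H K : Subgroup G} [H.Characteristic] [K.Characteristic] (hHK : H ≤ K) {g k l x : G}
    (hg : g ∈ H) (hg1 : g ≠ 1) (hk : k ∈ K) (hkH : k ∉ H) (hl : l ∈ K) (hlH : l ∉ H)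
    (hx : x ∉ K) : AutRel k l := by
  have h1 : ∀ {z : G}, z ∉ H → z ≠ 1 := by
    rintro z hz rfl
    exact hz H.one_mem
  rcases autRel_of_numAutOrbits_eq_four h4 hg1 (h1 fun h => hx (hHK h)) (h1 hkH) (h1 hlH)
    with h | h | h | h | h | h
  · exact absurd ((h.mem_iff K).1 (hHK hg)) hx
  · exact absurd ((h.mem_iff H).1 hg) hkH
  · exact absurd ((h.mem_iff H).1 hg) hlH
  · exact absurd ((h.mem_iff K).2 hk) hx
  · exact absurd ((h.mem_iff K).2 hl) hx
  · exact h

theorem AutRel.pow {G : Type*} [Group G] {a b : G} (h : AutRel a b) (n : ℕ) :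
    AutRel (a ^ n) (b ^ n) := by
  obtain ⟨φ, rfl⟩ := h
  exact ⟨φ, map_pow φ a n⟩

/-- Since `a` and `a ^ q` have the same order, each factor q can be stripped from the exponent. -/
theorem AutRel.eq_one_of_pow {G : Type*} [Group G] {a : G} {q : ℕ} (h : AutRel a (a ^ q)) :
    ∀ k : ℕ, a ^ q ^ k = 1 → a = 1
  | 0, hk => by simpa using hk
  | k + 1, hk => by
    rw [pow_succ', pow_mul, ← h.pow_eq_one_iff] at hk
    exact h.eq_one_of_pow k hk

theorem Subgroup.eq_top_of_forall_notMem {G : Type*} [Group G] {H K : Subgroup G} {x : G}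
    (hx : x ∉ H) (h : ∀ y ∉ H, y ∈ K) : K = ⊤ := by
  refine (Subgroup.eq_top_iff' K).2 fun g => ?_
  by_cases hg : g ∈ H
  · have h1 : g * x ∈ K := h _ fun h2 => hx ((H.mul_mem_cancel_left hg).1 h2)
    exact (K.mul_mem_cancel_right (h x hx)).1 h1
  · exact h g hg

/-! ### The commutator subgroup, its centralizer and the centre -/

theorem centralizer_commutator_eq_top_iff {G : Type*} [Group G] :
    Subgroup.centralizer (commutator G : Set G) = ⊤ ↔ commutator G ≤ Subgroup.center G := by
  rw [Subgroup.centralizer_eq_top_iff_subset]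
  rfl

open scoped commutatorElement in
-- As c commutes with [c,t], conjugating c ^ n by t multiplies it by [c,t]⁻ⁿ = 1.
theorem pow_mem_center_of_mem_centralizer_commutator {G : Type*} [Group G] {n : ℕ}
    (hn : ∀ g ∈ commutator G, g ^ n = 1) {c : G}
    (hc : c ∈ Subgroup.centralizer (commutator G : Set G)) : c ^ n ∈ Subgroup.center G := by
  rw [Subgroup.mem_center_iff]
  intro t
  have hmem : ⁅c, t⁆ ∈ commutator G :=
    Subgroup.commutator_mem_commutator (Subgroup.mem_top c) (Subgroup.mem_top t)
  have hcomm : Commute c ⁅c, t⁆ := (Subgroup.mem_centralizer_iff.1 hc _ hmem).symm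
  have h1 : t * c * t⁻¹ = ⁅c, t⁆⁻¹ * c := by
    rw [commutatorElement_def]
    group
  have h2 : t * c ^ n * t⁻¹ = c ^ n := by
    rw [← conj_pow, h1, (hcomm.inv_right.symm).mul_pow, inv_pow, hn _ hmem, inv_one, one_mul]
  exact mul_inv_eq_iff_eq_mul.1 h2

theorem IsPGroup.exists_mem_center_of_normal {G : Type*} [Group G] {p : ℕ} [Fact p.Prime]
    (hG : IsPGroup p G) (N : Subgroup G) [N.Normal] [Finite N] (hN : N ≠ ⊥) :
    ∃ g ∈ N, g ≠ 1 ∧ g ∈ Subgroup.center G := by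
  have hdvd : p ∣ Nat.card N :=
    (hG.to_subgroup N).card_eq_or_dvd.resolve_left fun h => hN (Subgroup.card_eq_one.1 h)
  obtain ⟨b, hb, hb1⟩ := (hG.of_equiv ConjAct.toConjAct).exists_fixed_point_of_prime_dvd_card_of_fixed_point
    N hdvd (a := 1) (fun g => by simp)
  refine ⟨b, b.2, fun h => hb1 (Subtype.ext h.symm), Subgroup.mem_center_iff.2 fun g => ?_⟩
  have h := congrArg Subtype.val (hb (ConjAct.toConjAct g))
  rw [ConjAct.Subgroup.val_conj_smul, ConjAct.smul_def, ConjAct.ofConjAct_toConjAct] at h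
  exact mul_inv_eq_iff_eq_mul.1 h

theorem exists_prime_forall_pow_eq_one {G : Type*} [Group G] {H : Subgroup G} [Finite H]
    {g : G} (hg : g ∈ H) (hg1 : g ≠ 1)
    (h : ∀ a ∈ H, ∀ b ∈ H, a ≠ 1 → b ≠ 1 → AutRel a b) :
    ∃ p : ℕ, p.Prime ∧ ∀ a ∈ H, a ^ p = 1 := by
  obtain ⟨p, hp, hpg⟩ := Nat.exists_prime_and_dvd (mt orderOf_eq_one_iff.1 hg1)
  have hfin : orderOf g ≠ 0 := by
    have := (isOfFinOrder_of_finite (⟨g, hg⟩ : H)).orderOf_pos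
    rw [Subgroup.orderOf_mk] at this
    exact this.ne'
  have hord : orderOf (g ^ (orderOf g / p)) = p := by
    exact orderOf_pow_orderOf_div hfin hpg
  refine ⟨p, hp, fun a ha => ?_⟩
  by_cases ha1 : a = 1
  · rw [ha1, one_pow]
  · have hne : g ^ (orderOf g / p) ≠ 1 := by
      intro h1
      rw [h1, orderOf_one] at hord
      exact hp.one_lt.ne hord
    rw [← (h _ (pow_mem hg _) a ha hne ha1).pow_eq_one_iff, ← orderOf_dvd_iff_pow_eq_one, hord]

theorem commutator_ne_bot_of_not_comm {G : Type*} [Group G] (hna : ∃ a b : G, a * b ≠ b * a) :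
    ∃ g ∈ commutator G, g ≠ 1 := by
  by_contra! h
  obtain ⟨a, b, hab⟩ := hna
  refine hab (commutatorElement_eq_one_iff_mul_comm.1 (h _ ?_))
  exact Subgroup.commutator_mem_commutator (Subgroup.mem_top a) (Subgroup.mem_top b)

theorem exists_notMem_commutator {G : Type*} [Group G] [Finite (commutator G)] {S : Set G}
    (hS : S.Infinite) : ∃ x ∈ S, x ∉ commutator G :=
  hS.exists_notMem_finite (Set.toFinite (commutator G : Set G))

/-! ### A single orbit outside the commutator subgroup -/

theorem commutator_le_center_of_autRel {G : Type*} [Group G] [Infinite G]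
    [Finite (commutator G)] (hFC : IsFCGroup G)
    (h : ∀ x ∉ commutator G, ∀ y ∉ commutator G, AutRel x y) :
    commutator G ≤ Subgroup.center G := by
  rw [← centralizer_commutator_eq_top_iff]
  have := hFC.finiteIndex_centralizer (Set.toFinite (commutator G : Set G))
  obtain ⟨c, hc, hcG⟩ := exists_notMem_commutator
    (Subgroup.FiniteIndex.infinite (Subgroup.centralizer (commutator G : Set G)))
  exact Subgroup.eq_top_of_forall_notMem hcG fun y hy => ((h c hcG y hy).mem_iff _).1 hc

theorem center_le_commutator_of_autRel {G : Type*} [Group G] (hna : ∃ a b : G, a * b ≠ b * a)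
    (h : ∀ x ∉ commutator G, ∀ y ∉ commutator G, AutRel x y) :
    Subgroup.center G ≤ commutator G := by
  intro z hz
  by_contra hzG
  have := Subgroup.eq_top_of_forall_notMem hzG fun y hy => ((h z hzG y hy).mem_iff _).1 hz
  obtain ⟨a, b, hab⟩ := hna
  exact hab (Subgroup.mem_center_iff.1 (this ▸ Subgroup.mem_top b) a)

theorem pow_eq_one_of_autRel {G : Type*} [Group G] [Infinite G] [Finite (commutator G)]
    (hFC : IsFCGroup G) (hna : ∃ a b : G, a * b ≠ b * a)
    (h : ∀ x ∉ commutator G, ∀ y ∉ commutator G, AutRel x y) {n : ℕ}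
    (hn : ∀ g ∈ commutator G, g ^ n = 1) (x : G) : x ^ n = 1 := by
  have htop := centralizer_commutator_eq_top_iff.2 (commutator_le_center_of_autRel hFC h)
  obtain ⟨y, hy, hyG⟩ := exists_notMem_commutator (hFC.infinite_pow_eq_one
    (Set.toFinite (commutator G : Set G)) n fun x => center_le_commutator_of_autRel hna h
      (pow_mem_center_of_mem_centralizer_commutator hn (htop ▸ Subgroup.mem_top x)))
  by_cases hx : x ∈ commutator G
  · exact hn x hx
  · exact ((h y hyG x hx).pow_eq_one_iff n).1 hy

/-- With four orbits, of which only one lies outside the commutator subgroup, the exponent divides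
the square of a prime. -/
theorem pow_prime_sq_eq_one_of_autRel {G : Type*} [Group G] [Infinite G]
    [Finite (commutator G)] (hFC : IsFCGroup G) (hna : ∃ a b : G, a * b ≠ b * a)
    (h4 : numAutOrbits G = 4)
    (h : ∀ x ∉ commutator G, ∀ y ∉ commutator G, AutRel x y) :
    ∃ p : ℕ, p.Prime ∧ ∀ x : G, x ^ p ^ 2 = 1 := by
  obtain ⟨x, -, hx⟩ := exists_notMem_commutator (Set.infinite_univ (α := G))
  have hx1 : x ≠ 1 := by
    rintro rfl
    exact hx (one_mem _)
  have hcard : ∀ g ∈ commutator G, g ^ Nat.card (commutator G) = 1 := fun g hg =>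
    congrArg Subtype.val (pow_card_eq_one' (x := (⟨g, hg⟩ : commutator G)))
  have hm : orderOf x ≠ 0 := fun h0 =>
    orderOf_eq_zero_iff'.1 h0 (Nat.card (commutator G)) Nat.card_pos
      (pow_eq_one_of_autRel hFC hna h hcard x)
  obtain ⟨p, k, hp, hk⟩ := exists_prime_pow_of_orderOf_eq (commutator G) hm hx
    fun y hy => (h y hy x hx).orderOf_eq
  -- `x * z` also lies outside G', so has the order of x, and z is central.
  have hz : ∀ z ∈ commutator G, z ^ p ^ k = 1 := by
    intro z hz
    have h1 : x * z ∉ commutator G := fun h2 => hx ((Subgroup.mul_mem_cancel_right _ hz).1 h2)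
    have h2 := ((h x hx _ h1).pow_eq_one_iff _).1 (pow_orderOf_eq_one x)
    have h3 : Commute x z := Subgroup.mem_center_iff.1 (commutator_le_center_of_autRel hFC h hz) x
    rwa [h3.mul_pow, pow_orderOf_eq_one, one_mul, hk] at h2
  refine ⟨p, hp, pow_eq_one_of_autRel hFC hna h fun z hzG => ?_⟩
  by_contra hz2
  have hzp : z ^ p ≠ 1 := by
    intro h1
    rw [pow_two, pow_mul, h1, one_pow] at hz2
    exact hz2 rfl
  have hz1 : z ≠ 1 := by
    rintro rfl
    exact hzp (one_pow p)
  have hno : ∀ i, ¬ AutRel (z ^ i) x := fun i hi => hx ((hi.mem_iff _).1 (pow_mem hzG i))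
  -- A p-element is never automorphic to a proper p-power of itself unless trivial, and x lies
  -- outside G'.
  rcases autRel_of_numAutOrbits_eq_four h4 hz1 hzp hz2 hx1 with h | h | h | h | h | h
  · exact hz1 (h.eq_one_of_pow k (hz z hzG))
  · exact hz1 (h.eq_one_of_pow k (by rw [pow_right_comm, pow_two, pow_mul, hz z hzG, one_pow]))
  · exact hno 1 (by rwa [pow_one])
  · rw [pow_two, pow_mul] at h
    exact hzp (h.eq_one_of_pow k (hz _ (pow_mem hzG p)))
  · exact hno p h
  · exact hno _ h

/-! ### Exponent when the commutator subgroup is central -/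

theorem isFCGroup_of_comm {A : Type*} [Group A] (h : ∀ a b : A, a * b = b * a) :
    IsFCGroup A := fun g =>
  (Set.finite_singleton g).subset fun x hx => by
    obtain ⟨c, rfl⟩ := isConj_iff.1 hx
    rw [h c g, mul_inv_cancel_right]
    rfl

theorem infinite_center_pow_eq_one {G : Type*} [Group G] [Infinite (Subgroup.center G)]
    {F : Set G} (hF : F.Finite) {n : ℕ} (h : ∀ z ∈ Subgroup.center G, z ^ n ∈ F) :
    {z : G | z ∈ Subgroup.center G ∧ z ^ n = 1}.Infinite := by
  have h1 := (isFCGroup_of_comm (A := Subgroup.center G) fun a b =>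
    Subtype.ext (Subgroup.mem_center_iff.1 b.2 a)).infinite_pow_eq_one
    (hF.preimage (Subtype.val_injective.injOn)) n fun z => h z z.2
  refine (h1.image Subtype.val_injective.injOn).mono ?_
  rintro _ ⟨z, hz, rfl⟩
  exact ⟨z.2, congrArg Subtype.val hz⟩

/-- If the commutator subgroup is central of prime exponent, then the exponent divides `p ^ 2`. -/
theorem pow_sq_eq_one_of_commutator_le_center {G : Type*} [Group G] [Infinite G]
    [Finite (commutator G)] (hFC : IsFCGroup G) (hna : ∃ a b : G, a * b ≠ b * a)
    (h4 : numAutOrbits G = 4) (hcen : commutator G ≤ Subgroup.center G) {p : ℕ}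
    (hp : ∀ g ∈ commutator G, g ^ p = 1) (x : G) : x ^ p ^ 2 = 1 := by
  obtain ⟨g, hg, hg1⟩ := commutator_ne_bot_of_not_comm hna
  have htop := centralizer_commutator_eq_top_iff.2 hcen
  have hpow : ∀ x : G, x ^ p ∈ Subgroup.center G := fun x =>
    pow_mem_center_of_mem_centralizer_commutator hp (htop ▸ Subgroup.mem_top x)
  suffices h : (∀ x : G, x ^ p ∈ commutator G) ∨ ∀ z ∈ Subgroup.center G, z ^ p = 1 by
    rw [pow_two, pow_mul]
    rcases h with h | h
    · exact hp _ (h x)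
    · exact h _ (hpow x)
  by_cases hZ : Subgroup.center G ≤ commutator G
  · exact Or.inl fun x => hZ (hpow x)
  obtain ⟨z, hz, hzG⟩ := SetLike.not_le_iff_exists.1 hZ
  obtain ⟨y, hy⟩ : ∃ y, y ∉ Subgroup.center G := by
    by_contra! h
    obtain ⟨a, b, hab⟩ := hna
    exact hab (Subgroup.mem_center_iff.1 (h b) a)
  have hrel1 : ∀ w ∈ Subgroup.center G, w ∉ commutator G → AutRel z w := fun w hw hwG =>
    autRel_of_mem_of_notMem h4 hcen hg hg1 hz hzG hw hwG hy
  have hrel2 : ∀ v ∉ Subgroup.center G, ∀ w ∉ Subgroup.center G, AutRel v w := fun v hv w hw =>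
    autRel_of_notMem_of_le h4 hcen hg hg1 hz hzG hv hw
  have hmul : ∀ w ∈ Subgroup.center G, y * w ∉ Subgroup.center G := fun w hw h =>
    hy ((Subgroup.mul_mem_cancel_right _ hw).1 h)
  have hmulpow : ∀ w ∈ Subgroup.center G, (y * w) ^ p = y ^ p * w ^ p := fun w hw =>
    (show Commute y w from Subgroup.mem_center_iff.1 hw y).mul_pow p
  by_cases hzp : z ^ p ∈ commutator G
  · have hZp : ∀ w ∈ Subgroup.center G, w ^ p ∈ commutator G := by
      intro w hw
      by_cases hwG : w ∈ commutator G
      · exact pow_mem hwG p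
      · exact (((hrel1 w hw hwG).pow p).mem_iff _).1 hzp
    by_cases hz1 : z ^ p = 1
    · right
      intro w hw
      by_cases hwG : w ∈ commutator G
      · exact hp w hwG
      · exact ((hrel1 w hw hwG).pow_eq_one_iff p).1 hz1
    · left
      -- A finite centre yields a noncentral v with v ^ p = 1; an infinite one yields w in Z(G) \ G'
      -- with w ^ p = 1, contradicting `hz1`.
      rcases finite_or_infinite (Subgroup.center G) with hfin | hinf
      · obtain ⟨v, hv, hvZ⟩ := (hFC.infinite_pow_eq_one
          (Set.toFinite (Subgroup.center G : Set G)) p hpow).exists_notMem_finite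
            (Set.toFinite (Subgroup.center G : Set G))
        intro w
        by_cases hw : w ∈ Subgroup.center G
        · exact hZp w hw
        · rw [((hrel2 v hvZ w hw).pow_eq_one_iff p).1 hv]
          exact one_mem _
      · obtain ⟨w, ⟨hw, hw1⟩, hwG⟩ := exists_notMem_commutator
          (infinite_center_pow_eq_one (Set.toFinite (commutator G : Set G)) hZp)
        exact absurd (((hrel1 w hw hwG).pow_eq_one_iff p).2 hw1) hz1
  · exfalso
    by_cases hyp : y ^ p ∈ commutator G
    · have h1 := (((hrel2 y hy _ (hmul z hz)).pow p).mem_iff (commutator G)).1 hyp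
      rw [hmulpow z hz] at h1
      exact hzp ((Subgroup.mul_mem_cancel_left _ hyp).1 h1)
    · have h1 : AutRel z (y ^ p) := hrel1 _ (hpow y) hyp
      -- All of Z(G) \ G' is in the orbit of z ^ p, so y ^ p = w ^ p with w central. Then y w⁻¹ is
      -- noncentral and killed by p, forcing y ^ p = 1.
      obtain ⟨φ, hφ⟩ := hrel1 _ (hpow z) hzp
      obtain ⟨ψ, hψ⟩ := h1
      have hw : ψ (φ.symm z) ∈ Subgroup.center G :=
        (AutRel.mem_iff ⟨ψ, rfl⟩ _).1 ((AutRel.mem_iff ⟨φ.symm, rfl⟩ _).1 hz)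
      have hwp : ψ (φ.symm z) ^ p = y ^ p := by
        rw [← map_pow, ← map_pow, ← hφ, MulEquiv.symm_apply_apply, hψ]
      have h2 : (y * (ψ (φ.symm z))⁻¹) ^ p = 1 := by
        rw [hmulpow _ (inv_mem hw), inv_pow, hwp, mul_inv_cancel]
      exact hyp (((hrel2 y hy _ (hmul _ (inv_mem hw))).pow_eq_one_iff p).2 h2 ▸ one_mem _)

/-! ### Centrality when G' \ {1} is one orbit -/

theorem commutator_le_center_of_autRel_of_prime {G : Type*} [Group G] [Infinite G]
    [Finite (commutator G)] (hFC : IsFCGroup G) (hna : ∃ a b : G, a * b ≠ b * a)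
    (h4 : numAutOrbits G = 4)
    (hrel : ∀ a ∈ commutator G, ∀ b ∈ commutator G, a ≠ 1 → b ≠ 1 → AutRel a b) {p : ℕ}
    (hpp : p.Prime) (hp : ∀ g ∈ commutator G, g ^ p = 1) :
    commutator G ≤ Subgroup.center G := by
  have := Fact.mk hpp
  obtain ⟨g, hg, hg1⟩ := commutator_ne_bot_of_not_comm hna
  have hne : commutator G ≠ ⊥ := fun h => hg1 (Subgroup.mem_bot.1 (h ▸ hg))
  have hchar : ∀ (H : Subgroup G) [H.Characteristic], ∀ a ∈ commutator G, a ≠ 1 → a ∈ H →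
      commutator G ≤ H := by
    intro H _ a ha ha1 haH b hb
    by_cases hb1 : b = 1
    · exact hb1 ▸ one_mem H
    · exact ((hrel a ha b hb ha1 hb1).mem_iff H).1 haH
  let C := Subgroup.centralizer (commutator G : Set G)
  have hCfin : C.FiniteIndex := hFC.finiteIndex_centralizer (Set.toFinite (commutator G : Set G))
  have hGC : commutator G ≤ C := by
    have hP : IsPGroup p (commutator G) := fun a => ⟨1, Subtype.ext (by simpa using hp a a.2)⟩
    obtain ⟨⟨a, ha⟩, -, ha1, haC⟩ := hP.exists_mem_center_of_normal ⊤
      (fun h => hg1 <| by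
        have h1 : (⟨g, hg⟩ : commutator G) = 1 := Subgroup.mem_bot.1 (h ▸ Subgroup.mem_top _)
        exact congrArg Subtype.val h1)
    refine hchar C a ha (fun h => ha1 (Subtype.ext h)) (Subgroup.mem_centralizer_iff.2 fun b hb => ?_)
    exact congrArg Subtype.val (Subgroup.mem_center_iff.1 haC ⟨b, hb⟩)
  rw [← centralizer_commutator_eq_top_iff]
  change C = ⊤
  by_contra htop
  obtain ⟨x, hx⟩ : ∃ x, x ∉ C := by
    by_contra! h
    exact htop ((Subgroup.eq_top_iff' C).2 h)
  obtain ⟨c, hc, hcG⟩ := exists_notMem_commutator (Subgroup.FiniteIndex.infinite C)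
  have hout : ∀ y ∉ C, AutRel y x := fun y hy =>
    autRel_of_notMem_of_le h4 hGC hg hg1 hc hcG hy hx
  have hmid : ∀ a ∈ C, a ∉ commutator G → ∀ b ∈ C, b ∉ commutator G → AutRel a b :=
    fun a ha haG b hb hbG => autRel_of_mem_of_notMem h4 hGC hg hg1 ha haG hb hbG hx
  have hnle : ¬ commutator G ≤ Subgroup.center G := fun h =>
    htop (centralizer_commutator_eq_top_iff.2 h)
  have hZ : ∀ z ∈ Subgroup.center G, z = 1 := by
    intro z hz
    by_contra hz1
    by_cases hzG : z ∈ commutator G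
    · exact hnle (hchar _ z hzG hz1 hz)
    · have hzC : z ∈ C := Subgroup.center_le_centralizer _ hz
      refine hnle fun a ha => ?_
      -- `a * z` shares the orbit of the central z, so it is central, and hence so is a.
      have h1 : a * z ∉ commutator G := fun h => hzG ((Subgroup.mul_mem_cancel_left _ ha).1 h)
      exact (Subgroup.mul_mem_cancel_right _ hz).1
        (((hmid z hzC hzG _ (mul_mem (hGC ha) hzC) h1).mem_iff _).1 hz)
  have hCp : ∀ c ∈ C, c ^ p = 1 := fun c hc =>
    hZ _ (pow_mem_center_of_mem_centralizer_commutator hp hc)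
  have hm : orderOf x ≠ 0 := by
    obtain ⟨n, hn, -, hxn⟩ := Subgroup.exists_pow_mem_of_index_ne_zero hCfin.index_ne_zero x
    intro h0
    refine orderOf_eq_zero_iff'.1 h0 (n * p) (Nat.mul_pos hn hpp.pos) ?_
    rw [pow_mul, hCp _ hxn]
  obtain ⟨q, k, hq, hk⟩ := exists_prime_pow_of_orderOf_eq C hm hx
    fun y hy => (hout y hy).orderOf_eq
  -- Some d ≠ 1 in C commutes with x; `x * d` has the order of x, which d of order p must therefore
  -- divide.
  have hpm : p ∣ orderOf x := by
    have := hFC.finiteIndex_centralizer_singleton x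
    obtain ⟨d, ⟨hdC, hdx⟩, hd1⟩ := (Subgroup.FiniteIndex.infinite
      (C ⊓ Subgroup.centralizer {x})).exists_notMem_finite (Set.finite_singleton 1)
    have hcomm : Commute x d := Subgroup.mem_centralizer_iff.1 hdx x rfl
    have h1 : x * d ∉ C := fun h => hx ((Subgroup.mul_mem_cancel_right _ hdC).1 h)
    have h2 := ((hout _ h1).pow_eq_one_iff _).2 (pow_orderOf_eq_one x)
    rw [hcomm.mul_pow, pow_orderOf_eq_one, one_mul] at h2
    rw [← orderOf_eq_prime (hCp d hdC) hd1]
    exact orderOf_dvd_of_pow_eq_one h2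
  have hpq : p = q := (Nat.prime_dvd_prime_iff_eq hpp hq).1 (hpp.dvd_of_dvd_pow (hk ▸ hpm))
  have hP : IsPGroup p G := by
    intro y
    by_cases hy : y ∈ C
    · exact ⟨1, by rw [pow_one, hCp y hy]⟩
    · exact ⟨k, by rw [hpq, ← hk, (hout y hy).pow_eq_one_iff, pow_orderOf_eq_one]⟩
  obtain ⟨a, -, ha1, haZ⟩ := hP.exists_mem_center_of_normal (commutator G) hne
  exact ha1 (hZ a haZ)

theorem mainTheorem6 (G : Type*) [Group G] [Infinite G]
    (hFC : IsFCGroup G) (hna : ∃ a b : G, a * b ≠ b * a) :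
    (numAutOrbits G = 3 →
      IsNilpotentOfClass G 2 ∧ ∃ p : ℕ, p.Prime ∧ Odd p ∧ Monoid.exponent G = p) ∧
    (numAutOrbits G = 4 →
      IsNilpotentOfClass G 2 ∧ ∃ p : ℕ, p.Prime ∧ Monoid.exponent G ∣ p ^ 2) := by
  obtain ⟨g, hg, hg1⟩ := commutator_ne_bot_of_not_comm hna
  have hne : ∀ {y : G}, y ∉ commutator G → y ≠ 1 := by
    rintro y hy rfl
    exact hy (one_mem _)
  constructor
  · intro h3
    have := hFC.finite_commutator (by omega)
    obtain ⟨x, -, hx⟩ := exists_notMem_commutator (Set.infinite_univ (α := G))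
    have hout : ∀ x ∉ commutator G, ∀ y ∉ commutator G, AutRel x y := by
      intro x hx y hy
      rcases autRel_of_numAutOrbits_eq_three h3 hg1 (hne hx) (hne hy) with h | h | h
      · exact absurd ((h.mem_iff _).1 hg) hx
      · exact absurd ((h.mem_iff _).1 hg) hy
      · exact h
    have hin : ∀ a ∈ commutator G, ∀ b ∈ commutator G, a ≠ 1 → b ≠ 1 → AutRel a b := by
      intro a ha b hb ha1 hb1
      rcases autRel_of_numAutOrbits_eq_three h3 ha1 hb1 (hne hx) with h | h | h
      · exact h
      · exact absurd ((h.mem_iff _).1 ha) hx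
      · exact absurd ((h.mem_iff _).1 hb) hx
    obtain ⟨p, hp, hGp⟩ := exists_prime_forall_pow_eq_one hg hg1 hin
    have hpow := pow_eq_one_of_autRel hFC hna hout hGp
    refine ⟨isNilpotentOfClass_two (commutator_le_center_of_autRel hFC hout) hna, p, hp, ?_, ?_⟩
    · refine hp.odd_of_ne_two ?_
      rintro rfl
      obtain ⟨a, b, hab⟩ := hna
      have hinv : ∀ x : G, x⁻¹ = x := fun x => by
        rw [inv_eq_iff_mul_eq_one, ← pow_two, hpow]
      exact hab (by rw [← hinv (a * b), mul_inv_rev, hinv, hinv])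
    · refine ((Nat.dvd_prime hp).1 (Monoid.exponent_dvd_of_forall_pow_eq_one hpow)).resolve_left ?_
      intro h1
      exact hg1 (by simpa [h1] using Monoid.pow_exponent_eq_one g)
  · intro h4
    have := hFC.finite_commutator (by omega)
    suffices h : commutator G ≤ Subgroup.center G ∧ ∃ p : ℕ, p.Prime ∧ ∀ x : G, x ^ p ^ 2 = 1 by
      obtain ⟨hcen, p, hp, hpow⟩ := h
      exact ⟨isNilpotentOfClass_two hcen hna, p, hp, Monoid.exponent_dvd_of_forall_pow_eq_one hpow⟩
    by_cases hin : ∀ a ∈ commutator G, ∀ b ∈ commutator G, a ≠ 1 → b ≠ 1 → AutRel a b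
    · obtain ⟨p, hp, hGp⟩ := exists_prime_forall_pow_eq_one hg hg1 hin
      have hcen := commutator_le_center_of_autRel_of_prime hFC hna h4 hin hp hGp
      exact ⟨hcen, p, hp, pow_sq_eq_one_of_commutator_le_center hFC hna h4 hcen hGp⟩
    · push Not at hin
      obtain ⟨a, ha, b, hb, ha1, hb1, hab⟩ := hin
      have hout : ∀ x ∉ commutator G, ∀ y ∉ commutator G, AutRel x y := by
        intro x hx y hy
        rcases autRel_of_numAutOrbits_eq_four h4 ha1 hb1 (hne hx) (hne hy)
          with h | h | h | h | h | h
        · exact absurd h hab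
        · exact absurd ((h.mem_iff _).1 ha) hx
        · exact absurd ((h.mem_iff _).1 ha) hy
        · exact absurd ((h.mem_iff _).1 hb) hx
        · exact absurd ((h.mem_iff _).1 hb) hy
        · exact h
      exact ⟨commutator_le_center_of_autRel hFC hout,
        pow_prime_sq_eq_one_of_autRel hFC hna h4 hout⟩
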